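/- Let $m\ge 1$ be an integer, $\alpha=-1/m$, $\rho>0$, $R>0$, and let $O=\mathcal B(0,R)\subset\mathbb C\cong\mathbb R^2$ be the closed disc of radius $R$ centred at the origin. Let $\mathcal K$ be a Ginibre $\alpha$-determinantal point process on $O$ of density $\rho$, that is, a simple, almost surely finite point process on $O$ whose $n$-th correlation function with respect to Lebesgue measure is, for every $n$, $$(x_1,\dots,x_n)\mapsto\sum_{\sigma\in S_n}\alpha^{\,n-\nu(\sigma)}\prod_{i=1}^n K(x_i,x_{\sigma(i)}),\qquad K(x,y)=\rho\, e^{\pi\rho x\bar y}e^{-\frac{\pi\rho}{2}(|x|^2+|y|^2)},$$ where $\nu(\sigma)$ is the number of cycles of $\sigma$. Let $\beta,P_S,G_S,G_H,\lambda,P_C>0$. For $\epsilon\ge 0$ let $$P_H^{\epsilon}=\sum_{x\in\mathcal K}\beta P_S\frac{G_SG_H\lambda^2}{(4\pi(\epsilon+\|x\|))^2}$$ be the power harvested by a sensor at the origin (with values in $[0,\infty]$), put $$\gamma=\sqrt{\frac{\beta P_SG_SG_H\lambda^2}{(4\pi)^2P_C}},\qquad \Gamma(z,a)=\int_0^a e^{-t}t^{z-1}\,dt,\qquad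 B(r)=\Big(\prod_{n\ge 0}\Big(1+\alpha\,\frac{\Gamma(n+1,\pi\rho r^2)}{n!}\Big)\Big)^{-1/\alpha}.$$ Then the infinite product defining $B(r)$ converges for every $r\in\mathbb R$, and the power-outage probability satisfies: 1. without regularisation of the distance, $\Pr(P_H^{0}<P_C)\le B(\min(R,\gamma))$; 2. for every fixed $\epsilon\in[0,\gamma]$, $\Pr(P_H^{\epsilon}<P_C)\le B(\min(R,\gamma-\epsilon))$; 3. in the limit of a vanishing regularisation, $\lim_{\epsilon\downarrow 0}\Pr(P_H^{\epsilon}<P_C)$ exists and is at most $B(\min(R,\gamma))$. -/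

import Mathlib

open MeasureTheory Filter Topology

noncomputable section

/-- `𝒦` is a (simple, almost surely finite) point process on the window `O` of the complex plane:
a random set of points, almost surely a finite subset of `O`, such that the number of points in
each Borel set is a random variable. -/
structure IsPointProcess {Ω : Type*} [MeasurableSpace Ω] (μ : Measure Ω) (O : Set ℂ)
    (𝒦 : Ω → Set ℂ) : Prop where
  measurable_count : ∀ B : Set ℂ, MeasurableSet B → Measurable fun ω => (𝒦 ω ∩ B).encard
  ae_finite : ∀ᵐ ω ∂μ, (𝒦 ω).Finite
  ae_subset : ∀ᵐ ω ∂μ, 𝒦 ω ⊆ O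

/-- The number of `n`-tuples of pairwise distinct points of the configuration `S` that belong
to `A`. -/
def factorialCount (S : Set ℂ) (n : ℕ) (A : Set (Fin n → ℂ)) : ℕ∞ :=
  {x : Fin n → ℂ | Function.Injective x ∧ (∀ i, x i ∈ S) ∧ x ∈ A}.encard

/-- The number of cycles of a permutation, fixed points included. -/
def numCycles {n : ℕ} (σ : Equiv.Perm (Fin n)) : ℕ :=
  Multiset.card σ.partition.parts

/-- The `α`-determinant `∑_σ α ^ (n - ν(σ)) ∏ i, M i (σ i)`, with `ν(σ)` the number of cycles. -/
def alphaDet (α : ℝ) {n : ℕ} (M : Matrix (Fin n) (Fin n) ℂ) : ℂ :=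
  ∑ σ : Equiv.Perm (Fin n), (α : ℂ) ^ (n - numCycles σ) * ∏ i, M i (σ i)

/-- `𝒦` is an `α`-determinantal point process on the bounded window `O` with kernel `K`: for
every `n` its `n`-th correlation function with respect to Lebesgue measure is
`(x₁, …, xₙ) ↦ det_α (K (xᵢ, xⱼ))`. In other words, the `n`-th factorial moment measure
`A ↦ E[#{n-tuples of distinct points of 𝒦 lying in A}]` on `Oⁿ` is finite and has this density. -/
structure IsAlphaDPP {Ω : Type*} [MeasurableSpace Ω] (μ : Measure Ω) (O : Set ℂ)
    (α : ℝ) (K : ℂ → ℂ → ℂ) (𝒦 : Ω → Set ℂ) : Prop extends IsPointProcess μ O 𝒦 where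
  factorial_moment_ne_top : ∀ (n : ℕ) (A : Set (Fin n → ℂ)), MeasurableSet A →
    (∀ x ∈ A, ∀ i, x i ∈ O) →
      ∫⁻ ω, (factorialCount (𝒦 ω) n A : ENNReal) ∂μ ≠ ⊤
  integrableOn_density : ∀ (n : ℕ) (A : Set (Fin n → ℂ)), MeasurableSet A →
    (∀ x ∈ A, ∀ i, x i ∈ O) →
      IntegrableOn (fun x : Fin n → ℂ => alphaDet α (Matrix.of fun i j => K (x i) (x j))) A
  factorial_moment_eq : ∀ (n : ℕ) (A : Set (Fin n → ℂ)), MeasurableSet A →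
    (∀ x ∈ A, ∀ i, x i ∈ O) →
      (((∫⁻ ω, (factorialCount (𝒦 ω) n A : ENNReal) ∂μ).toReal : ℝ) : ℂ) =
        ∫ x in A, alphaDet α (Matrix.of fun i j => K (x i) (x j))

/-- The Ginibre kernel of density `ρ`:
`K(x, y) = ρ exp(π ρ x ȳ) exp(-(π ρ / 2) (|x|² + |y|²))`. -/
def ginibreKernel (ρ : ℝ) (x y : ℂ) : ℂ :=
  (ρ : ℂ) * Complex.exp ((Real.pi : ℂ) * ρ * x * (starRingEnd ℂ) y) *
    Complex.exp (-((Real.pi : ℂ) * ρ / 2) * ((‖x‖ : ℂ) ^ 2 + (‖y‖ : ℂ) ^ 2))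

/-- The lower incomplete Gamma function `Γ(z, a) = ∫₀ᵃ e^{-t} t^{z-1} dt`. -/
def lowerGamma (z a : ℝ) : ℝ :=
  ∫ t in (0 : ℝ)..a, Real.exp (-t) * t ^ (z - 1)

/-- The power harvested (Friis equation) by the sensor at the origin from a source located at `x`,
where the distance is regularised by `ε`: `β P_S G_S G_H λ² / (4 π (ε + ‖x‖))²`. It is
extended-valued: for `ε = 0` a source located exactly at the sensor delivers infinite power. -/
def sourcePower (β PS GS GH wl ε : ℝ) (x : ℂ) : ENNReal :=
  ENNReal.ofReal (β * PS * GS * GH * wl ^ 2) / ENNReal.ofReal ((4 * Real.pi * (ε + ‖x‖)) ^ 2)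

/-- The aggregated harvested power `P_H`, summed over the configuration `S` of sources. -/
def harvestedPower (β PS GS GH wl ε : ℝ) (S : Set ℂ) : ENNReal :=
  ∑' x : S, sourcePower β PS GS GH wl ε x

/-- The power outage probability `Pr(P_H < P_C)`. -/
def outageProb {Ω : Type*} [MeasurableSpace Ω] (μ : Measure Ω) (𝒦 : Ω → Set ℂ)
    (β PS GS GH wl PC ε : ℝ) : ℝ :=
  μ.real {ω | harvestedPower β PS GS GH wl ε (𝒦 ω) < ENNReal.ofReal PC}

/-- The radius `γ = √(β P_S G_S G_H λ² / ((4π)² P_C))`. -/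
def gammaRadius (β PS GS GH wl PC : ℝ) : ℝ :=
  Real.sqrt (β * PS * GS * GH * wl ^ 2 / ((4 * Real.pi) ^ 2 * PC))

/-- The `n`-th factor `1 + α Γ(n+1, π ρ r²) / n!`. -/
def boundFactor (α ρ r : ℝ) (n : ℕ) : ℝ :=
  1 + α * (lowerGamma ((n : ℝ) + 1) (Real.pi * ρ * r ^ 2) / (n.factorial : ℝ))

/-- The bound `(∏_{n ≥ 0} (1 + α Γ(n+1, π ρ r²) / n!)) ^ (-1/α)`. -/
def outageBound (α ρ r : ℝ) : ℝ :=
  (∏' n : ℕ, boundFactor α ρ r n) ^ (-1 / α)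

end

/-! A single source within distance `γ - ε` already delivers `PC`, so outage forces the disc of
radius `min R (γ - ε)` to contain no point (`outage_subset_voidEvent`). It remains to bound a void
probability (`measureReal_voidEvent_le_outageBound`).

On a centred disc the monomial modes diagonalise the Ginibre kernel, with eigenvalues `Γ(n+1,
πρr²)/n!`. For `α = -1/m`, the power `α ^ (n - ν(σ))` is `sign σ` times an average over
`m`-colourings constant on the cycles of `σ`. The `α`-determinant thus behaves like an ordinary
determinant whose spectrum has each eigenvalue split into `m` equal parts. For a rank-`L`
truncation, its integral over the `n`-fold product of the disc is `n!` times the `n`-th elementary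
symmetric function of these parts (`setIntegral_alphaDet_truncatedKernel`), and `L → ∞` gives the
factorial moments.

Bonferroni's inequalities bound the void probability by alternating sums of these moments. Such sums
differ from `∏ (1 - w)` by at most a tail of the exponential series, controlled uniformly in `L`
(`abs_sum_range_sub_prod_one_sub_le`); so `L → ∞`, then the Bonferroni order tends to infinity.

As `ε ↓ 0`, monotonicity gives the limit, and closed discs exhaust an open one whose boundary is
null. No continuity of the bound in `r` is needed. -/

noncomputable section

/-! ### Cycles, colourings and powers of `α = -1/m`. -/

namespace Equiv.Perm

variable {ι : Type*} [Fintype ι] [DecidableEq ι]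

/-- `cycleOf` sends every fixed point to `1`, so it separates only the nontrivial cycles; the second
component tells the fixed points apart. -/
theorem sameCycle_iff_cycleOf_eq_and (σ : Perm ι) (x y : ι) :
    σ.SameCycle x y ↔ σ.cycleOf x = σ.cycleOf y ∧
      (if x ∈ σ.support then none else some x) = (if y ∈ σ.support then none else some y) := by
  by_cases hx : x ∈ σ.support <;> by_cases hy : y ∈ σ.support
  · simp [sameCycle_iff_cycleOf_eq_of_mem_support hx hy, hx, hy]
  · simp only [hx, hy, if_true, if_false, reduceCtorEq, and_false, iff_false]
    intro h
    exact hy (mem_support.2 ((h.apply_eq_self_iff).not.1 (mem_support.1 hx)))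
  · simp only [hx, hy, if_true, if_false, reduceCtorEq, and_false, iff_false]
    intro h
    exact hx (mem_support.2 ((h.apply_eq_self_iff).not.2 (mem_support.1 hy)))
  · simp only [hx, hy, if_false, Option.some.injEq]
    constructor
    · intro h
      have : x = y := (h.eq_of_left (by simpa [Function.IsFixedPt] using hx))
      subst this; simp
    · rintro ⟨-, rfl⟩; exact SameCycle.refl _ _

theorem card_quotient_sameCycle (σ : Perm ι) :
    Nat.card (Quotient (SameCycle.setoid σ)) = Multiset.card σ.partition.parts := by
  classical
  let f : ι → Perm ι × Option ι :=
    fun x => (σ.cycleOf x, if x ∈ σ.support then none else some x)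
  have hker : SameCycle.setoid σ = Setoid.ker f := by
    ext x y
    rw [Setoid.ker_def]
    change σ.SameCycle x y ↔ _
    rw [sameCycle_iff_cycleOf_eq_and, Prod.ext_iff]
  have himage : Finset.univ.image f =
      σ.cycleFactorsFinset.image (fun c => (c, none)) ∪
        σ.supportᶜ.image (fun x => (1, some x)) := by
    ext ⟨c, o⟩
    simp only [Finset.mem_image, Finset.mem_univ, true_and, Finset.mem_union,
      Finset.mem_compl, f, Prod.mk.injEq]
    constructor
    · rintro ⟨x, rfl, rfl⟩
      by_cases hx : x ∈ σ.support
      · exact Or.inl ⟨_, cycleOf_mem_cycleFactorsFinset_iff.2 hx, rfl, by simp [hx]⟩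
      · exact Or.inr ⟨x, hx, (cycleOf_eq_one_iff σ |>.2 (by simpa using hx)).symm, by simp [hx]⟩
    · rintro (⟨c', hc, rfl, rfl⟩ | ⟨x, hx, rfl, rfl⟩)
      · obtain ⟨x, hx⟩ := (mem_cycleFactorsFinset_iff.1 hc).1.nonempty_support
        refine ⟨x, (cycle_is_cycleOf hx hc).symm, ?_⟩
        simp [mem_cycleFactorsFinset_support_le hc hx]
      · exact ⟨x, (cycleOf_eq_one_iff σ |>.2 (by simpa using hx)), by simp [hx]⟩
  have hcard : (Finset.univ.image f).card = Multiset.card σ.partition.parts := by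
    rw [himage, Finset.card_union_of_disjoint, Finset.card_image_of_injective,
      Finset.card_image_of_injective, parts_partition, Multiset.card_add,
      Multiset.card_replicate, cycleType_def, Multiset.card_map, Finset.card_compl]
    · rfl
    · intro a b h; simpa using h
    · intro a b h; simpa using h
    · rw [Finset.disjoint_left]
      intro p hp hq
      simp only [Finset.mem_image] at hp hq
      obtain ⟨_, _, rfl⟩ := hp
      obtain ⟨_, _, h⟩ := hq
      simp at h
  rw [hker, Nat.card_congr (Setoid.quotientKerEquivRange f), ← hcard, ← Set.ncard_coe_finset,
    Finset.coe_image, Finset.coe_univ, Set.image_univ, _root_.Nat.card_coe_set_eq]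

/-- The maps that are constant on the cycles of a permutation are the maps on its set of cycles. -/
def invariantEquiv (σ : Perm ι) (κ : Type*) :
    {c : ι → κ // ∀ i, c i = c (σ i)} ≃ (Quotient (SameCycle.setoid σ) → κ) where
  toFun c := Quotient.lift c.1 (by
    rintro a b ⟨k, rfl⟩
    have key : ∀ j : ℕ, ∀ x, c.1 ((σ ^ j) x) = c.1 x := by
      intro j
      induction j with
      | zero => simp
      | succ j ih => intro x; rw [pow_succ, mul_apply, ih, ← c.2 x]
    obtain ⟨j, rfl | rfl⟩ := k.eq_nat_or_neg
    · simp [key]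
    · have := key j ((σ ^ (-(j : ℤ))) a)
      rw [← this, zpow_neg, zpow_natCast, ← mul_apply, mul_inv_cancel, one_apply])
  invFun d := ⟨fun i => d (Quotient.mk _ i), fun i => congrArg d (Quotient.sound ⟨1, by simp⟩)⟩
  left_inv c := rfl
  right_inv d := by
    funext q
    induction q using Quotient.ind
    rfl

theorem card_invariant (σ : Perm ι) (m : ℕ) :
    (Finset.univ.filter fun c : ι → Fin m => ∀ i, c i = c (σ i)).card =
      m ^ Multiset.card σ.partition.parts := by
  rw [← Fintype.card_subtype, ← Nat.card_eq_fintype_card,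
    Nat.card_congr (invariantEquiv σ (Fin m)), Nat.card_fun, card_quotient_sameCycle]
  simp

end Equiv.Perm

theorem numCycles_le {n : ℕ} (σ : Equiv.Perm (Fin n)) : numCycles σ ≤ n := by
  unfold numCycles
  have h := σ.partition.parts_sum
  have h2 : Multiset.card σ.partition.parts • 1 ≤ σ.partition.parts.sum :=
    Multiset.card_nsmul_le_sum fun x hx => σ.partition.parts_pos hx
  simp at h h2
  omega

theorem sign_eq_neg_one_pow_numCycles {n : ℕ} (σ : Equiv.Perm (Fin n)) :
    (Equiv.Perm.sign σ : ℤˣ) = (-1) ^ (n - numCycles σ) := by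
  have h1 := Equiv.Perm.sign_of_cycleType σ
  have h2 := σ.sum_cycleType
  have h3 := Finset.card_le_univ σ.support
  have h4 := numCycles_le σ
  have h5 : numCycles σ = Multiset.card σ.cycleType + (n - σ.support.card) := by
    simp [numCycles, Equiv.Perm.parts_partition]
  simp only [Fintype.card_fin] at h3
  rw [h1, h2]
  have : σ.support.card + Multiset.card σ.cycleType =
      (n - numCycles σ) + 2 * Multiset.card σ.cycleType := by omega
  rw [this, pow_add, pow_mul]
  simp

/-- The sign of `σ` is `(-1) ^ (n - ν(σ))`, and `m ^ ν(σ)` counts the colourings constant on the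
cycles of `σ`. -/
theorem alpha_pow_eq_sum_invariant {m n : ℕ} (hm : 0 < m) (σ : Equiv.Perm (Fin n)) :
    (((-1 / (m : ℝ) : ℝ)) : ℂ) ^ (n - numCycles σ) =
      (1 / (m : ℂ)) ^ n * ∑ c : Fin n → Fin m,
        ((Equiv.Perm.sign σ : ℤ) : ℂ) * ∏ i, if c i = c (σ i) then 1 else 0 := by
  have hm' : (m : ℂ) ≠ 0 := by exact_mod_cast hm.ne'
  have hcount : (∑ c : Fin n → Fin m, ∏ i, (if c i = c (σ i) then (1 : ℂ) else 0)) =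
      (m : ℂ) ^ numCycles σ := by
    have := Equiv.Perm.card_invariant σ m
    simp_rw [Finset.prod_ite_zero, Finset.prod_const_one]
    rw [Finset.sum_ite]
    simp only [Finset.sum_const, nsmul_eq_mul, mul_one, mul_zero, add_zero, Finset.mem_univ,
      forall_true_left]
    rw [← Nat.cast_pow]
    refine congrArg _ (Eq.trans ?_ this)
    congr!
  rw [← Finset.mul_sum, hcount, sign_eq_neg_one_pow_numCycles]
  have hn : (m : ℂ) ^ n = m ^ (n - numCycles σ) * m ^ numCycles σ := by
    rw [← pow_add, Nat.sub_add_cancel (numCycles_le σ)]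
  push_cast
  rw [div_pow, div_pow, one_pow, hn]
  field_simp

/-! ### Injective sums, elementary symmetric functions and their alternating sums. -/

section InjectiveSums

/-- The left side is a determinant: that of the identity when `κ` is injective, and one with two
equal rows otherwise. -/
theorem sum_sign_mul_prod_ite_eq {ι : Type*} [DecidableEq ι] {n : ℕ} (κ : Fin n → ι) :
    ∑ σ : Equiv.Perm (Fin n), ((Equiv.Perm.sign σ : ℤ) : ℂ) *
      ∏ i, (if κ i = κ (σ i) then (1 : ℂ) else 0) = if Function.Injective κ then 1 else 0 := by
  have hdet : ∑ σ : Equiv.Perm (Fin n), ((Equiv.Perm.sign σ : ℤ) : ℂ) *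
      ∏ i, (if κ i = κ (σ i) then (1 : ℂ) else 0) =
      (Matrix.of fun i j => if κ j = κ i then (1 : ℂ) else 0).det := by
    rw [Matrix.det_apply']
    rfl
  rw [hdet]
  split_ifs with h
  · have h1 : (Matrix.of fun i j => if κ j = κ i then (1 : ℂ) else 0) = 1 := by
      ext i j
      simp [Matrix.one_apply, h.eq_iff, eq_comm]
    rw [h1, Matrix.det_one]
  · simp only [Function.Injective, not_forall] at h
    obtain ⟨i, j, hij, hne⟩ := h
    exact Matrix.det_zero_of_row_eq hne (by ext k; simp [hij])

theorem sum_injective_prod_eq {ι : Type*} [Fintype ι] [DecidableEq ι]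
    {R : Type*} [CommRing R] (w : ι → R) (n : ℕ) :
    (∑ κ : Fin n → ι, if Function.Injective κ then ∏ i, w (κ i) else 0) =
      n.factorial * ∑ t ∈ Finset.univ.powersetCard n, ∏ i ∈ t, w i := by
  rw [← Finset.sum_filter]
  rw [← Finset.sum_fiberwise_of_maps_to (s := Finset.univ.filter Function.Injective)
    (t := Finset.univ.powersetCard n) (g := fun κ : Fin n → ι => Finset.univ.image κ)]
  · rw [Finset.mul_sum]
    refine Finset.sum_congr rfl fun t ht => ?_
    have hcard := (Finset.mem_powersetCard.1 ht).2
    have hconst : ∀ κ ∈ (Finset.univ.filter Function.Injective).filter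
        (fun κ : Fin n → ι => Finset.univ.image κ = t), ∏ i, w (κ i) = ∏ i ∈ t, w i := by
      intro κ hκ
      simp only [Finset.mem_filter, Finset.mem_univ, true_and] at hκ
      rw [← hκ.2, Finset.prod_image (fun _ _ _ _ h => hκ.1 h)]
    rw [Finset.sum_congr rfl hconst, Finset.sum_const, nsmul_eq_mul]
    congr 2
    let e : {κ // κ ∈ (Finset.univ.filter Function.Injective).filter
        (fun κ : Fin n → ι => Finset.univ.image κ = t)} ≃ (Fin n ↪ t) :=
      { toFun := fun κ => ⟨fun i => ⟨κ.1 i, by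
            have := (Finset.mem_filter.1 κ.2).2
            exact this.subset (Finset.mem_image_of_mem _ (Finset.mem_univ _))⟩, by
            intro i j h
            have hinj := (Finset.mem_filter.1 (Finset.mem_filter.1 κ.2).1).2
            exact hinj (by simpa using h)⟩
        invFun := fun f => ⟨fun i => f i, by
            have hinj : Function.Injective fun i => (f i : ι) :=
              Subtype.val_injective.comp f.injective
            simp only [Finset.mem_filter, Finset.mem_univ, true_and]
            refine ⟨hinj, Finset.eq_of_subset_of_card_le ?_ ?_⟩
            · intro x hx
              obtain ⟨i, -, rfl⟩ := Finset.mem_image.1 hx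
              exact (f i).2
            · rw [Finset.card_image_of_injective _ hinj, hcard]; simp⟩
        left_inv := fun κ => rfl
        right_inv := fun f => rfl }
    have := Fintype.card_congr e
    rw [Fintype.card_coe, Fintype.card_embedding_eq, Fintype.card_coe, hcard, Fintype.card_fin,
      Nat.descFactorial_self] at this
    exact this
  · intro κ hκ
    have := (Finset.mem_filter.1 hκ).2
    simp [Finset.mem_powersetCard, Finset.card_image_of_injective _ this]

/-- Multiplied by `n!`, the left side sums over injective tuples only, while the power `(∑ w) ^ n`
sums over all tuples. -/
theorem sum_powersetCard_prod_le {ι : Type*} [Fintype ι] [DecidableEq ι]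
    (w : ι → ℝ) (hw : ∀ i, 0 ≤ w i) (n : ℕ) :
    ∑ t ∈ Finset.univ.powersetCard n, ∏ i ∈ t, w i ≤ (∑ i, w i) ^ n / n.factorial := by
  rw [le_div_iff₀ (by positivity), mul_comm, ← sum_injective_prod_eq, ← Fin.prod_const,
    Finset.prod_univ_sum]
  rw [Fintype.piFinset_univ]
  refine Finset.sum_le_sum fun κ _ => ?_
  split_ifs
  · exact le_rfl
  · exact Finset.prod_nonneg fun i _ => hw _

theorem prod_one_sub_eq_sum_range {ι : Type*} [Fintype ι] (w : ι → ℝ) :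
    ∏ i, (1 - w i) = ∑ n ∈ Finset.range (Fintype.card ι + 1),
      (-1) ^ n * ∑ t ∈ Finset.univ.powersetCard n, ∏ i ∈ t, w i := by
  have h := Finset.prod_one_add (f := fun i => -w i) (Finset.univ : Finset ι)
  simp only [← sub_eq_add_neg] at h
  rw [h, Finset.sum_powerset]
  refine Finset.sum_congr rfl fun n _ => ?_
  rw [Finset.mul_sum]
  refine Finset.sum_congr rfl fun t ht => ?_
  rw [Finset.prod_neg, (Finset.mem_powersetCard.1 ht).2]

/-- The error depends on `w` only through its sum, so it survives a limit in which the index set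
grows. -/
theorem abs_sum_range_sub_prod_one_sub_le {ι : Type*} [Fintype ι] [DecidableEq ι]
    (w : ι → ℝ) (hw : ∀ i, 0 ≤ w i) (k : ℕ) :
    |∑ n ∈ Finset.range k, (-1) ^ n * ∑ t ∈ Finset.univ.powersetCard n, ∏ i ∈ t, w i
        - ∏ i, (1 - w i)| ≤
      Real.exp (∑ i, w i) - ∑ n ∈ Finset.range k, (∑ i, w i) ^ n / n.factorial := by
  set e : ℕ → ℝ := fun n => ∑ t ∈ Finset.univ.powersetCard n, ∏ i ∈ t, w i with he
  set S := ∑ i, w i with hS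
  have he0 : ∀ n, 0 ≤ e n := fun n =>
    Finset.sum_nonneg fun t _ => Finset.prod_nonneg fun i _ => hw i
  have hle : ∀ n, e n ≤ S ^ n / n.factorial := fun n => sum_powersetCard_prod_le w hw n
  have hS0 : 0 ≤ S := Finset.sum_nonneg fun i _ => hw i
  -- Large enough to exceed both `k` and the last nonzero elementary symmetric function.
  set N := k + (Fintype.card ι + 1) with hN
  have hprod : ∏ i, (1 - w i) = ∑ n ∈ Finset.range N, (-1) ^ n * e n := by
    rw [prod_one_sub_eq_sum_range]
    refine Finset.sum_subset (Finset.range_mono (by omega)) fun n _ hn => ?_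
    have : Finset.powersetCard n (Finset.univ : Finset ι) = ∅ :=
      Finset.powersetCard_eq_empty.2 (by simp at hn ⊢; omega)
    simp [this]
  have hexp : ∑ n ∈ Finset.range N, S ^ n / n.factorial ≤ Real.exp S :=
    Real.sum_le_exp_of_nonneg hS0 N
  rw [hprod]
  have hsplit : ∀ g : ℕ → ℝ, ∑ n ∈ Finset.range N, g n =
      ∑ n ∈ Finset.range k, g n + ∑ n ∈ Finset.Ico k N, g n := fun g =>
    (Finset.sum_range_add_sum_Ico g (by omega)).symm
  rw [hsplit] at hexp ⊢
  rw [sub_add_cancel_left, abs_neg]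
  calc |∑ n ∈ Finset.Ico k N, (-1) ^ n * e n|
      ≤ ∑ n ∈ Finset.Ico k N, |(-1) ^ n * e n| := Finset.abs_sum_le_sum_abs _ _
    _ ≤ ∑ n ∈ Finset.Ico k N, S ^ n / n.factorial := by
        refine Finset.sum_le_sum fun n _ => ?_
        rw [abs_mul, abs_pow, abs_neg, abs_one, one_pow, one_mul, abs_of_nonneg (he0 n)]
        exact hle n
    _ ≤ _ := by linarith

end InjectiveSums

/-! ### Ginibre eigenvalues, modes and finite-rank truncations. -/

theorem lowerGamma_add_one (n : ℕ) (a : ℝ) :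
    lowerGamma ((n : ℝ) + 1) a = ∫ t in (0 : ℝ)..a, Real.exp (-t) * t ^ n := by
  simp [lowerGamma]

theorem lowerGamma_add_one_nonneg (n : ℕ) {a : ℝ} (ha : 0 ≤ a) :
    0 ≤ lowerGamma ((n : ℝ) + 1) a := by
  rw [lowerGamma_add_one]
  exact intervalIntegral.integral_nonneg ha fun t ht =>
    mul_nonneg (Real.exp_pos _).le (pow_nonneg ht.1 n)

theorem lowerGamma_add_one_le (n : ℕ) {a : ℝ} (ha : 0 ≤ a) :
    lowerGamma ((n : ℝ) + 1) a ≤ a * a ^ n := by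
  rw [lowerGamma_add_one]
  calc ∫ t in (0 : ℝ)..a, Real.exp (-t) * t ^ n ≤ ∫ _ in (0 : ℝ)..a, a ^ n := by
        refine intervalIntegral.integral_mono_on ha
          (Continuous.intervalIntegrable (by fun_prop) _ _)
          (Continuous.intervalIntegrable (by fun_prop) _ _) fun t ht => ?_
        calc Real.exp (-t) * t ^ n ≤ 1 * a ^ n := by
              have h0 := ht.1
              have h1 := ht.2
              gcongr
              exact Real.exp_le_one_iff.2 (by linarith)
          _ = a ^ n := one_mul _
    _ = a * a ^ n := by simp

/-- The eigenvalues `Γ(n+1, π ρ r²) / n!` of the Ginibre kernel on the disc of radius `r`. -/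
def ginibreEigenvalue (ρ r : ℝ) (n : ℕ) : ℝ :=
  lowerGamma ((n : ℝ) + 1) (Real.pi * ρ * r ^ 2) / n.factorial

theorem ginibreEigenvalue_nonneg {ρ : ℝ} (hρ : 0 ≤ ρ) (r : ℝ) (n : ℕ) :
    0 ≤ ginibreEigenvalue ρ r n :=
  div_nonneg (lowerGamma_add_one_nonneg n (by positivity)) (by positivity)

theorem summable_ginibreEigenvalue {ρ : ℝ} (hρ : 0 ≤ ρ) (r : ℝ) :
    Summable (ginibreEigenvalue ρ r) := by
  have ha : 0 ≤ Real.pi * ρ * r ^ 2 := by positivity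
  refine Summable.of_nonneg_of_le (ginibreEigenvalue_nonneg hρ r) (fun n => ?_)
    ((Real.summable_pow_div_factorial (Real.pi * ρ * r ^ 2)).mul_left (Real.pi * ρ * r ^ 2))
  rw [ginibreEigenvalue, ← mul_div_assoc]
  gcongr
  exact lowerGamma_add_one_le n ha

/-- The eigenfunctions of the Ginibre kernel on centred discs. -/
def ginibreMode (ρ : ℝ) (n : ℕ) (x : ℂ) : ℂ :=
  (√(ρ * (Real.pi * ρ) ^ n / n.factorial) * Real.exp (-(Real.pi * ρ / 2) * ‖x‖ ^ 2) : ℝ) * x ^ n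

@[fun_prop]
theorem continuous_ginibreMode (ρ : ℝ) (n : ℕ) : Continuous (ginibreMode ρ n) := by
  unfold ginibreMode
  fun_prop

/-- The Ginibre kernel truncated to its first `L` modes. -/
def truncatedKernel (ρ : ℝ) (L : ℕ) (x y : ℂ) : ℂ :=
  ∑ l : Fin L, ginibreMode ρ l x * (starRingEnd ℂ) (ginibreMode ρ l y)

theorem ginibreMode_mul_conj {ρ : ℝ} (hρ : 0 ≤ ρ) (n : ℕ) (x y : ℂ) :
    ginibreMode ρ n x * (starRingEnd ℂ) (ginibreMode ρ n y) =
      (ρ * Real.exp (-(Real.pi * ρ / 2) * (‖x‖ ^ 2 + ‖y‖ ^ 2)) : ℝ) *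
        ((Real.pi * ρ * x * (starRingEnd ℂ) y) ^ n / n.factorial) := by
  have h : √(ρ * (Real.pi * ρ) ^ n / n.factorial) * √(ρ * (Real.pi * ρ) ^ n / n.factorial) =
      ρ * (Real.pi * ρ) ^ n / n.factorial := Real.mul_self_sqrt (by positivity)
  have h' : (√(ρ * (Real.pi * ρ) ^ n / n.factorial) : ℂ) *
      (√(ρ * (Real.pi * ρ) ^ n / n.factorial) : ℂ) =
      ρ * (Real.pi * ρ) ^ n / n.factorial := by exact_mod_cast congrArg (Complex.ofReal) h
  have hexp : Real.exp (-(Real.pi * ρ / 2) * (‖x‖ ^ 2 + ‖y‖ ^ 2)) =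
      Real.exp (-(Real.pi * ρ / 2) * ‖x‖ ^ 2) * Real.exp (-(Real.pi * ρ / 2) * ‖y‖ ^ 2) := by
    rw [← Real.exp_add]; ring_nf
  simp only [ginibreMode, map_mul, map_pow, Complex.conj_ofReal, hexp]
  push_cast only [Complex.ofReal_mul]
  linear_combination (Complex.ofReal (Real.exp (-(Real.pi * ρ / 2) * ‖x‖ ^ 2))) *
    (Complex.ofReal (Real.exp (-(Real.pi * ρ / 2) * ‖y‖ ^ 2))) * x ^ n * (starRingEnd ℂ) y ^ n * h'

theorem truncatedKernel_eq {ρ : ℝ} (hρ : 0 ≤ ρ) (L : ℕ) (x y : ℂ) :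
    truncatedKernel ρ L x y =
      (ρ * Real.exp (-(Real.pi * ρ / 2) * (‖x‖ ^ 2 + ‖y‖ ^ 2)) : ℝ) *
        ∑ l ∈ Finset.range L, (Real.pi * ρ * x * (starRingEnd ℂ) y) ^ l / l.factorial := by
  rw [truncatedKernel, Finset.mul_sum, Finset.sum_range]
  exact Finset.sum_congr rfl fun l _ => ginibreMode_mul_conj hρ l x y

/-- The bound is independent of `L`, as dominated convergence requires. -/
theorem norm_truncatedKernel_le {ρ : ℝ} (hρ : 0 ≤ ρ) (L : ℕ) {r : ℝ} {x y : ℂ}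
    (hx : ‖x‖ ≤ r) (hy : ‖y‖ ≤ r) :
    ‖truncatedKernel ρ L x y‖ ≤ ρ * Real.exp (Real.pi * ρ * r ^ 2) := by
  have hr : 0 ≤ r := (norm_nonneg x).trans hx
  rw [truncatedKernel_eq hρ, norm_mul]
  have h1 : ‖((ρ * Real.exp (-(Real.pi * ρ / 2) * (‖x‖ ^ 2 + ‖y‖ ^ 2)) : ℝ) : ℂ)‖ ≤ ρ := by
    rw [Complex.norm_real, Real.norm_of_nonneg (by positivity)]
    refine mul_le_of_le_one_right hρ (Real.exp_le_one_iff.2 ?_)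
    have : 0 ≤ Real.pi * ρ / 2 * (‖x‖ ^ 2 + ‖y‖ ^ 2) := by positivity
    linarith
  have h2 : ‖∑ l ∈ Finset.range L,
      ((Real.pi : ℂ) * ρ * x * (starRingEnd ℂ) y) ^ l / l.factorial‖ ≤
      Real.exp (Real.pi * ρ * r ^ 2) := by
    refine (norm_sum_le _ _).trans ?_
    refine le_trans ?_ (Real.sum_le_exp_of_nonneg (by positivity) L)
    refine Finset.sum_le_sum fun l _ => ?_
    rw [norm_div, norm_pow, Complex.norm_natCast]
    gcongr
    simp only [norm_mul, Complex.norm_real, RCLike.norm_conj, Real.norm_of_nonneg hρ,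
      Real.norm_of_nonneg Real.pi_pos.le]
    rw [mul_assoc, sq]
    gcongr
  gcongr

theorem tendsto_truncatedKernel {ρ : ℝ} (hρ : 0 ≤ ρ) (x y : ℂ) :
    Tendsto (fun L => truncatedKernel ρ L x y) atTop (𝓝 (ginibreKernel ρ x y)) := by
  simp_rw [truncatedKernel_eq hρ]
  have h := (NormedSpace.expSeries_div_hasSum_exp
    ((Real.pi : ℂ) * ρ * x * (starRingEnd ℂ) y)).tendsto_sum_nat
  rw [← Complex.exp_eq_exp_ℂ] at h
  convert! h.const_mul _ using 2
  rw [ginibreKernel]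
  push_cast
  ring

/-! ### Orthogonality of the modes on centred discs. -/

theorem setIntegral_closedBall_norm {r : ℝ} (hr : 0 ≤ r) (f : ℝ → ℝ) :
    ∫ x in Metric.closedBall (0 : ℂ) r, f ‖x‖ = 2 * Real.pi * ∫ s in (0 : ℝ)..r, s * f s := by
  have h1 : ∫ x in Metric.closedBall (0 : ℂ) r, f ‖x‖ =
      ∫ x : ℂ, (Set.Iic r).indicator f ‖x‖ := by
    rw [← integral_indicator Metric.isClosed_closedBall.measurableSet]
    congr 1
    ext x
    simp [Set.indicator]
  have h2 : (volume : Measure ℂ).real (Metric.ball 0 1) = Real.pi := by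
    simp [Measure.real, Complex.volume_ball]
  rw [h1, integral_fun_norm_addHaar, Complex.finrank_real_complex, h2,
    intervalIntegral.integral_of_le hr]
  have h3 : ∀ y : ℝ, y ^ (2 - 1) • (Set.Iic r).indicator f y =
      (Set.Iic r).indicator (fun s => s * f s) y := by
    intro y
    by_cases hy : y ≤ r <;> simp [hy]
  simp_rw [h3]
  rw [setIntegral_indicator measurableSet_Iic, Set.Ioi_inter_Iic]
  simp [mul_assoc]

/-- The integrand is radial: polar coordinates and the substitution `t = πρs²` produce the
incomplete Gamma integral. -/
theorem setIntegral_normSq_ginibreMode {ρ r : ℝ} (hρ : 0 < ρ) (hr : 0 ≤ r) (n : ℕ) :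
    ∫ x in Metric.closedBall (0 : ℂ) r, ginibreMode ρ n x * (starRingEnd ℂ) (ginibreMode ρ n x) =
      (ginibreEigenvalue ρ r n : ℂ) := by
  have h1 : ∀ x : ℂ, ginibreMode ρ n x * (starRingEnd ℂ) (ginibreMode ρ n x) =
      ((ρ * Real.exp (-(Real.pi * ρ * ‖x‖ ^ 2)) *
        ((Real.pi * ρ * ‖x‖ ^ 2) ^ n / n.factorial) : ℝ) : ℂ) := by
    intro x
    rw [ginibreMode_mul_conj hρ.le, mul_assoc _ x, Complex.mul_conj, Complex.normSq_eq_norm_sq]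
    have : -(Real.pi * ρ / 2) * (‖x‖ ^ 2 + ‖x‖ ^ 2) = -(Real.pi * ρ * ‖x‖ ^ 2) := by ring
    rw [this]
    push_cast
    ring
  simp_rw [h1]
  rw [integral_complex_ofReal]
  congr 1
  rw [setIntegral_closedBall_norm hr (fun s => ρ * Real.exp (-(Real.pi * ρ * s ^ 2)) *
        ((Real.pi * ρ * s ^ 2) ^ n / n.factorial)), ginibreEigenvalue, lowerGamma_add_one]
  have hsub := intervalIntegral.integral_comp_mul_deriv (a := 0) (b := r)
    (f := fun s => Real.pi * ρ * s ^ 2) (f' := fun s => Real.pi * ρ * (2 * s))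
    (g := fun t => Real.exp (-t) * t ^ n)
    (fun x _ => by simpa using (hasDerivAt_pow 2 x).const_mul (Real.pi * ρ))
    (by fun_prop) (by fun_prop)
  simp only [Function.comp, ne_eq, OfNat.ofNat_ne_zero, not_false_eq_true, zero_pow,
    mul_zero] at hsub
  rw [← hsub, ← intervalIntegral.integral_const_mul, ← intervalIntegral.integral_div]
  congr 1
  ext s
  ring

/-- A suitable rotation preserves the disc and its measure but negates the integrand, so the
integral equals its own opposite. -/
theorem setIntegral_ginibreMode_mul_conj_of_ne {ρ : ℝ} (r : ℝ) {k l : ℕ} (hkl : k ≠ l) :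
    ∫ x in Metric.closedBall (0 : ℂ) r,
      ginibreMode ρ k x * (starRingEnd ℂ) (ginibreMode ρ l x) = 0 := by
  set I := ∫ x in Metric.closedBall (0 : ℂ) r,
      ginibreMode ρ k x * (starRingEnd ℂ) (ginibreMode ρ l x) with hI
  -- Chosen so that the phase `exp (i (k - l) θ)` equals `-1`.
  set θ : ℝ := Real.pi / ((k : ℝ) - l) with hθ
  let a : Circle := Circle.exp θ
  have hkl' : (k : ℝ) - l ≠ 0 := sub_ne_zero.2 (by exact_mod_cast hkl)
  have ha : (a : ℂ) ^ k * (starRingEnd ℂ) (a : ℂ) ^ l = -1 := by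
    rw [Circle.coe_exp, ← Complex.exp_conj, ← Complex.exp_nat_mul, ← Complex.exp_nat_mul,
      ← Complex.exp_add, ← Complex.exp_pi_mul_I]
    congr 1
    simp only [map_mul, Complex.conj_ofReal, Complex.conj_I]
    have : ((k : ℝ) - l) * θ = Real.pi := by rw [hθ]; field_simp
    have h2 : ((k : ℂ) - l) * θ = Real.pi := by exact_mod_cast congrArg Complex.ofReal this
    rw [← h2]
    ring
  have hinv := (rotation a).measurePreserving.setIntegral_preimage_emb
    (rotation a).toHomeomorph.measurableEmbedding
    (fun x => ginibreMode ρ k x * (starRingEnd ℂ) (ginibreMode ρ l x))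
    (Metric.closedBall (0 : ℂ) r)
  rw [LinearIsometryEquiv.preimage_closedBall, map_zero, ← hI] at hinv
  have hrot : ∀ x : ℂ, ginibreMode ρ k (rotation a x) *
      (starRingEnd ℂ) (ginibreMode ρ l (rotation a x)) =
      -(ginibreMode ρ k x * (starRingEnd ℂ) (ginibreMode ρ l x)) := by
    intro x
    simp only [ginibreMode, rotation_apply, norm_mul, Circle.norm_coe, one_mul, map_mul, map_pow,
      mul_pow (a : ℂ), Complex.conj_ofReal]
    linear_combination ((√(ρ * (Real.pi * ρ) ^ k / k.factorial) *
      Real.exp (-(Real.pi * ρ / 2) * ‖x‖ ^ 2) : ℝ) : ℂ) * x ^ k *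
      ((√(ρ * (Real.pi * ρ) ^ l / l.factorial) *
      Real.exp (-(Real.pi * ρ / 2) * ‖x‖ ^ 2) : ℝ) : ℂ) * (starRingEnd ℂ) x ^ l * ha
  simp_rw [hrot] at hinv
  rw [integral_neg, ← hI] at hinv
  linear_combination (-1 / 2 : ℂ) * hinv

theorem setIntegral_ginibreMode_mul_conj {ρ r : ℝ} (hρ : 0 < ρ) (hr : 0 ≤ r) (k l : ℕ) :
    ∫ x in Metric.closedBall (0 : ℂ) r, ginibreMode ρ k x * (starRingEnd ℂ) (ginibreMode ρ l x) =
      if k = l then (ginibreEigenvalue ρ r k : ℂ) else 0 := by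
  split_ifs with h
  · subst h
    exact setIntegral_normSq_ginibreMode hρ hr k
  · exact setIntegral_ginibreMode_mul_conj_of_ne r h

/-! ### Integrals of `α`-determinants over products of discs. -/

/-- The eigenvalues of the Ginibre kernel on the disc of radius `r`, each split into `m` equal
parts. -/
def splitEigenvalue (ρ r : ℝ) (L m : ℕ) (p : Fin L × Fin m) : ℝ :=
  ginibreEigenvalue ρ r p.1 / m

/-- Expanding over mode labels `k` and collecting the factors in each `x i` lets Fubini and
orthogonality act one variable at a time. -/
theorem setIntegral_prod_truncatedKernel {ρ r : ℝ} (hρ : 0 < ρ) (hr : 0 ≤ r) (L n : ℕ)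
    (σ : Equiv.Perm (Fin n)) :
    ∫ x in Set.univ.pi fun _ : Fin n => Metric.closedBall (0 : ℂ) r,
        ∏ i, truncatedKernel ρ L (x i) (x (σ i)) =
      ∑ k : Fin n → Fin L, ∏ i,
        (ginibreEigenvalue ρ r (k i) : ℂ) * if k i = k (σ i) then 1 else 0 := by
  have hexpand : ∀ x : Fin n → ℂ, ∏ i, truncatedKernel ρ L (x i) (x (σ i)) =
      ∑ k : Fin n → Fin L, ∏ i, (ginibreMode ρ (k i) (x i) *
        (starRingEnd ℂ) (ginibreMode ρ (k (σ⁻¹ i)) (x i))) := by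
    intro x
    simp only [truncatedKernel]
    rw [Finset.prod_univ_sum, Fintype.piFinset_univ]
    refine Finset.sum_congr rfl fun k _ => ?_
    rw [Finset.prod_mul_distrib, Finset.prod_mul_distrib]
    congr 1
    refine Eq.trans ?_ (Equiv.prod_comp σ fun i =>
      (starRingEnd ℂ) (ginibreMode ρ (k (σ⁻¹ i)) (x i)))
    simp
  simp_rw [hexpand]
  rw [integral_finsetSum]
  · refine Finset.sum_congr rfl fun k _ => ?_
    rw [volume_pi, Measure.restrict_pi_pi, integral_fintype_prod_eq_prod
      (f := fun i z => ginibreMode ρ (k i) z * (starRingEnd ℂ) (ginibreMode ρ (k (σ⁻¹ i)) z)),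
      -- Reindexing by `σ` turns the pair `k i`, `k (σ⁻¹ i)` into `k (σ i)`, `k i`.
      ← Equiv.prod_comp σ]
    refine Finset.prod_congr rfl fun i _ => ?_
    rw [setIntegral_ginibreMode_mul_conj hρ hr]
    by_cases h : k i = k (σ i)
    · simp [h]
    · simp [h, Fin.val_inj, Ne.symm h]
  · intro k _
    refine ContinuousOn.integrableOn_compact
      (isCompact_univ_pi fun _ => isCompact_closedBall _ _) (Continuous.continuousOn ?_)
    fun_prop

theorem setIntegral_alphaDet_truncatedKernel {ρ r : ℝ} (hρ : 0 < ρ) (hr : 0 ≤ r) {m : ℕ}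
    (hm : 0 < m) (L n : ℕ) :
    ∫ x in Set.univ.pi fun _ : Fin n => Metric.closedBall (0 : ℂ) r,
        alphaDet (-1 / (m : ℝ)) (Matrix.of fun i j => truncatedKernel ρ L (x i) (x j)) =
      ((n.factorial * ∑ t ∈ Finset.univ.powersetCard n, ∏ p ∈ t, splitEigenvalue ρ r L m p : ℝ) :
        ℂ) := by
  simp only [alphaDet, Matrix.of_apply]
  rw [integral_finsetSum]
  · simp_rw [integral_const_mul, setIntegral_prod_truncatedKernel hρ hr,
      alpha_pow_eq_sum_invariant hm]
    rw [← sum_injective_prod_eq]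
    push_cast
    have hterm : ∀ κ : Fin n → Fin L × Fin m,
        ((if Function.Injective κ then ∏ i, splitEigenvalue ρ r L m (κ i) else 0 : ℝ) : ℂ) =
        ∑ σ : Equiv.Perm (Fin n), (∏ i, (splitEigenvalue ρ r L m (κ i) : ℂ)) *
          (((Equiv.Perm.sign σ : ℤ) : ℂ) * ∏ i, (if κ i = κ (σ i) then (1 : ℂ) else 0)) := by
      intro κ
      rw [← Finset.mul_sum, sum_sign_mul_prod_ite_eq]
      split_ifs <;> simp
    simp_rw [hterm]
    rw [Finset.sum_comm]
    refine Finset.sum_congr rfl fun σ _ => ?_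
    -- A map into `Fin L × Fin m` is a mode labelling together with a colouring; equality of pairs
    -- then factors into the two indicators.
    rw [← (Equiv.arrowProdEquivProdArrow (Fin n) (fun _ => Fin L) (fun _ => Fin m)).symm.sum_comp,
      Fintype.sum_prod_type, mul_assoc, Finset.sum_mul_sum, Finset.mul_sum, Finset.sum_comm]
    simp_rw [Finset.mul_sum]
    refine Finset.sum_congr rfl fun c _ => Finset.sum_congr rfl fun k _ => ?_
    have hsplit : ∀ (i) [Decidable ((k i, c i) = (k (σ i), c (σ i)))],
        (if (k i, c i) = (k (σ i), c (σ i)) then (1 : ℂ) else 0) =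
          (if k i = k (σ i) then 1 else 0) * (if c i = c (σ i) then 1 else 0) := by
      intro i _
      by_cases h1 : k i = k (σ i) <;> by_cases h2 : c i = c (σ i) <;> simp [h1, h2]
    change _ = (∏ i, (splitEigenvalue ρ r L m (k i, c i) : ℂ)) * (((Equiv.Perm.sign σ : ℤ) : ℂ) *
      ∏ i, if (k i, c i) = (k (σ i), c (σ i)) then (1 : ℂ) else 0)
    simp only [splitEigenvalue, hsplit,
      Finset.prod_mul_distrib, Complex.ofReal_div, Finset.prod_div_distrib, Finset.prod_const,
      Finset.card_univ, Fintype.card_fin, Complex.ofReal_natCast, one_div, inv_pow]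
    ring
  · intro σ _
    refine ContinuousOn.integrableOn_compact
      (isCompact_univ_pi fun _ => isCompact_closedBall _ _) (Continuous.continuousOn ?_)
    unfold truncatedKernel
    fun_prop

theorem tendsto_setIntegral_alphaDet_truncatedKernel {ρ : ℝ} (hρ : 0 ≤ ρ) (α r : ℝ) (n : ℕ) :
    Tendsto (fun L => ∫ x in Set.univ.pi fun _ : Fin n => Metric.closedBall (0 : ℂ) r,
        alphaDet α (Matrix.of fun i j => truncatedKernel ρ L (x i) (x j))) atTop
      (𝓝 (∫ x in Set.univ.pi fun _ : Fin n => Metric.closedBall (0 : ℂ) r,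
        alphaDet α (Matrix.of fun i j => ginibreKernel ρ (x i) (x j)))) := by
  have hcompact : IsCompact (Set.univ.pi fun _ : Fin n => Metric.closedBall (0 : ℂ) r) :=
    isCompact_univ_pi fun _ => isCompact_closedBall _ _
  refine tendsto_integral_of_dominated_convergence
    (fun _ => ∑ σ : Equiv.Perm (Fin n), ‖(α : ℂ) ^ (n - numCycles σ)‖ *
      ∏ _i : Fin n, (ρ * Real.exp (Real.pi * ρ * r ^ 2))) ?_ ?_ ?_ ?_
  · intro L
    refine Continuous.aestronglyMeasurable ?_
    simp only [alphaDet, Matrix.of_apply, truncatedKernel]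
    fun_prop
  · exact integrableOn_const hcompact.measure_lt_top.ne
  · intro L
    filter_upwards [ae_restrict_mem hcompact.measurableSet] with x hx
    have hx' : ∀ i, ‖x i‖ ≤ r := fun i => by simpa using hx i (Set.mem_univ i)
    refine (norm_sum_le _ _).trans (Finset.sum_le_sum fun σ _ => ?_)
    rw [norm_mul, norm_prod]
    gcongr with i
    exact norm_truncatedKernel_le hρ L (hx' i) (hx' (σ i))
  · refine Eventually.of_forall fun x => ?_
    simp only [alphaDet, Matrix.of_apply]
    exact tendsto_finsetSum _ fun σ _ => (tendsto_finsetProd _ fun i _ =>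
      tendsto_truncatedKernel hρ (x i) (x (σ i))).const_mul _

/-! ### Factorial moments and Bonferroni bounds for void probabilities. -/

theorem factorialCount_pi {S D : Set ℂ} (h : (S ∩ D).Finite) (n : ℕ) :
    factorialCount S n (Set.univ.pi fun _ => D) = ((S ∩ D).ncard.descFactorial n : ℕ) := by
  have : Fintype ↥(S ∩ D) := h.fintype
  let e : {x : Fin n → ℂ | Function.Injective x ∧ (∀ i, x i ∈ S) ∧ x ∈ Set.univ.pi fun _ => D} ≃
      (Fin n ↪ ↥(S ∩ D)) :=
    { toFun := fun x => ⟨fun i => ⟨x.1 i, x.2.2.1 i, x.2.2.2 i (Set.mem_univ i)⟩,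
        fun i j hij => x.2.1 (congrArg Subtype.val hij)⟩
      invFun := fun f => ⟨fun i => f i, Subtype.val_injective.comp f.injective,
        fun i => (f i).2.1, fun i _ => (f i).2.2⟩
      left_inv := fun x => rfl
      right_inv := fun f => rfl }
  rw [factorialCount, ← ENat.card_coe_set_eq, ENat.card_congr e, ENat.card_eq_coe_fintype_card,
    Fintype.card_embedding_eq, Fintype.card_fin, ← Nat.card_coe_set_eq, Nat.card_eq_fintype_card]

/-- For `N > 0` the alternating binomial sum telescopes to `(N - 1).choose (2 * k)`; stopping at an
even index makes its sign positive. -/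
theorem ite_eq_zero_le_alternating_sum_descFactorial (N k : ℕ) :
    (if N = 0 then (1 : ℝ) else 0) ≤ ∑ n ∈ Finset.range (2 * k + 1),
      (-1) ^ n * ((N.descFactorial n : ℝ) / n.factorial) := by
  have h : ∀ n, ((N.descFactorial n : ℝ) / n.factorial) = N.choose n := by
    intro n
    rw [Nat.descFactorial_eq_factorial_mul_choose, Nat.cast_mul]
    field_simp
  simp_rw [h]
  cases N with
  | zero => rw [Finset.sum_range_succ']; simp
  | succ N =>
    have := Int.alternating_sum_range_choose_eq_choose (n := N) (m := 2 * k)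
    have h2 : (∑ n ∈ Finset.range (2 * k + 1), ((-1) ^ n * ((N + 1).choose n : ℝ))) =
        (-1) ^ (2 * k) * (N.choose (2 * k) : ℝ) := by exact_mod_cast this
    rw [h2, pow_mul]
    simp

/-- The set of configurations without points in `D`. -/
def voidEvent {Ω : Type*} (𝒦 : Ω → Set ℂ) (D : Set ℂ) : Set Ω :=
  {ω | 𝒦 ω ∩ D = ∅}

section PointProcess

variable {Ω : Type*} [MeasurableSpace Ω] {μ : Measure Ω} {O : Set ℂ} {𝒦 : Ω → Set ℂ}

theorem IsPointProcess.measurableSet_voidEvent (h : IsPointProcess μ O 𝒦) {D : Set ℂ}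
    (hD : MeasurableSet D) : MeasurableSet (voidEvent 𝒦 D) := by
  have : voidEvent 𝒦 D = (fun ω => (𝒦 ω ∩ D).encard) ⁻¹' {0} := by
    ext ω; simp [voidEvent]
  rw [this]
  exact h.measurable_count D hD (measurableSet_singleton 0)

theorem IsPointProcess.measureReal_voidEvent_le [IsProbabilityMeasure μ]
    (h : IsPointProcess μ O 𝒦) {D : Set ℂ} (hD : MeasurableSet D)
    (hfin : ∀ n : ℕ,
      ∫⁻ ω, (factorialCount (𝒦 ω) n (Set.univ.pi fun _ => D) : ENNReal) ∂μ ≠ ⊤) (k : ℕ) :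
    μ.real (voidEvent 𝒦 D) ≤ ∑ n ∈ Finset.range (2 * k + 1), (-1) ^ n *
      ((∫⁻ ω, (factorialCount (𝒦 ω) n (Set.univ.pi fun _ => D) : ENNReal) ∂μ).toReal /
        n.factorial) := by
  set N : Ω → ℕ := fun ω => (𝒦 ω ∩ D).ncard with hN
  have hNmeas : Measurable N :=
    (measurable_from_top (f := ENat.toNat)).comp (h.measurable_count D hD)
  have hlint : ∀ n : ℕ,
      ∫⁻ ω, (factorialCount (𝒦 ω) n (Set.univ.pi fun _ => D) : ENNReal) ∂μ =
        ∫⁻ ω, ((N ω).descFactorial n : ENNReal) ∂μ := by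
    intro n
    refine lintegral_congr_ae ?_
    filter_upwards [h.ae_finite] with ω hω
    rw [factorialCount_pi (hω.inter_of_left D)]
    simp [hN]
  have hmeas : ∀ n : ℕ, Measurable fun ω => ((N ω).descFactorial n : ENNReal) := fun n =>
    (measurable_from_top (f := fun j : ℕ => ((j.descFactorial n : ℕ) : ENNReal))).comp hNmeas
  have hint : ∀ n : ℕ, Integrable (fun ω => ((N ω).descFactorial n : ℝ)) μ := by
    intro n
    have := integrable_toReal_of_lintegral_ne_top (hmeas n).aemeasurable (hlint n ▸ hfin n)
    simpa using this
  have hmoment : ∀ n : ℕ,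
      (∫⁻ ω, (factorialCount (𝒦 ω) n (Set.univ.pi fun _ => D) : ENNReal) ∂μ).toReal =
        ∫ ω, ((N ω).descFactorial n : ℝ) ∂μ := by
    intro n
    rw [hlint, ← integral_toReal (hmeas n).aemeasurable (by simp)]
    simp
  have hvoid := h.measurableSet_voidEvent hD
  simp_rw [hmoment]
  rw [← integral_indicator_one hvoid]
  calc ∫ ω, (voidEvent 𝒦 D).indicator 1 ω ∂μ
      ≤ ∫ ω, ∑ n ∈ Finset.range (2 * k + 1),
          (-1) ^ n * (((N ω).descFactorial n : ℝ) / n.factorial) ∂μ := by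
        refine integral_mono_ae ((integrable_const (1 : ℝ)).indicator hvoid)
          (integrable_finsetSum _ fun n _ => ((hint n).div_const _).const_mul _) ?_
        filter_upwards [h.ae_finite] with ω hω
        refine le_trans (le_of_eq ?_) (ite_eq_zero_le_alternating_sum_descFactorial (N ω) k)
        by_cases h0 : 𝒦 ω ∩ D = ∅ <;>
          simp [Set.indicator, voidEvent, hN, Set.ncard_eq_zero (hω.inter_of_left D), h0]
    _ = _ := by
        rw [integral_finsetSum _ fun n _ => ((hint n).div_const _).const_mul _]
        simp_rw [integral_const_mul, integral_div]

end PointProcess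

/-! ### The infinite product as a bound on void probabilities. -/

theorem boundFactor_eq (α ρ r : ℝ) :
    boundFactor α ρ r = fun n => 1 + α * ginibreEigenvalue ρ r n := rfl

theorem multipliable_boundFactor {ρ : ℝ} (hρ : 0 ≤ ρ) (α r : ℝ) :
    Multipliable (boundFactor α ρ r) := by
  rw [boundFactor_eq]
  exact Real.multipliable_one_add_of_summable ((summable_ginibreEigenvalue hρ r).mul_left α)

theorem sum_splitEigenvalue (ρ r : ℝ) (L : ℕ) {m : ℕ} (hm : 0 < m) :
    ∑ p, splitEigenvalue ρ r L m p = ∑ l ∈ Finset.range L, ginibreEigenvalue ρ r l := by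
  have hm' : (m : ℝ) ≠ 0 := by exact_mod_cast hm.ne'
  simp only [splitEigenvalue, Fintype.sum_prod_type, Finset.sum_const, Finset.card_univ,
    Fintype.card_fin, nsmul_eq_mul, mul_div_cancel₀ _ hm', Finset.sum_range]

theorem prod_one_sub_splitEigenvalue (ρ r : ℝ) (L m : ℕ) :
    ∏ p, (1 - splitEigenvalue ρ r L m p) =
      (∏ l ∈ Finset.range L, boundFactor (-1 / (m : ℝ)) ρ r l) ^ m := by
  simp only [splitEigenvalue, Fintype.prod_prod_type, Finset.prod_const, Finset.card_univ,
    Fintype.card_fin, Finset.prod_pow, Finset.prod_range, boundFactor_eq]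
  congr 1
  refine Finset.prod_congr rfl fun l _ => ?_
  ring

theorem outageBound_eq_pow {m : ℕ} (hm : 0 < m) (ρ r : ℝ) :
    outageBound (-1 / (m : ℝ)) ρ r = (∏' n, boundFactor (-1 / (m : ℝ)) ρ r n) ^ m := by
  have hm' : (m : ℝ) ≠ 0 := by exact_mod_cast hm.ne'
  have : -1 / (-1 / (m : ℝ)) = m := by field_simp
  rw [outageBound, this, Real.rpow_natCast]

section AlphaDPP

variable {Ω : Type*} [MeasurableSpace Ω] {μ : Measure Ω} {𝒦 : Ω → Set ℂ} {ρ R : ℝ} {m : ℕ}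

/-- This lets an open disc replace the closed one, which the limit `ε ↓ 0` requires. -/
theorem setIntegral_pi_congr_ae {D D' : Set ℂ} (hD : D =ᵐ[volume] D') (n : ℕ)
    (f : (Fin n → ℂ) → ℂ) :
    ∫ x in Set.univ.pi fun _ => D, f x = ∫ x in Set.univ.pi fun _ => D', f x := by
  simp_rw [volume_pi, Measure.restrict_pi_pi, Measure.restrict_congr_set hD]

theorem tendsto_factorial_moment (hρ : 0 < ρ) (hm : 0 < m)
    (h𝒦 : IsAlphaDPP μ (Metric.closedBall (0 : ℂ) R) (-1 / (m : ℝ)) (ginibreKernel ρ) 𝒦)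
    {r : ℝ} (hr : 0 ≤ r) {D : Set ℂ} (hDm : MeasurableSet D)
    (hDO : D ⊆ Metric.closedBall 0 R) (hDr : D =ᵐ[volume] Metric.closedBall (0 : ℂ) r) (n : ℕ) :
    Tendsto (fun L => ∑ t ∈ Finset.univ.powersetCard n, ∏ p ∈ t, splitEigenvalue ρ r L m p)
      atTop (𝓝 ((∫⁻ ω, (factorialCount (𝒦 ω) n (Set.univ.pi fun _ => D) : ENNReal) ∂μ).toReal /
        n.factorial)) := by
  have h := tendsto_setIntegral_alphaDet_truncatedKernel hρ.le (-1 / (m : ℝ)) r n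
  rw [← setIntegral_pi_congr_ae hDr n (fun x => alphaDet (-1 / (m : ℝ))
      (Matrix.of fun i j => ginibreKernel ρ (x i) (x j))),
    ← h𝒦.factorial_moment_eq n _ (MeasurableSet.univ_pi fun _ => hDm)
      (fun x hx i => hDO (hx i (Set.mem_univ i)))] at h
  simp_rw [setIntegral_alphaDet_truncatedKernel hρ hr hm] at h
  have h2 := ((Complex.continuous_re.tendsto _).comp h).div_const (n.factorial : ℝ)
  simp only [Function.comp_def, Complex.ofReal_re] at h2
  convert! h2 using 2 with L
  field_simp

theorem measureReal_voidEvent_le_outageBound [IsProbabilityMeasure μ] (hρ : 0 < ρ) (hm : 0 < m)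
    (h𝒦 : IsAlphaDPP μ (Metric.closedBall (0 : ℂ) R) (-1 / (m : ℝ)) (ginibreKernel ρ) 𝒦)
    {r : ℝ} (hr : 0 ≤ r) {D : Set ℂ} (hDm : MeasurableSet D)
    (hDO : D ⊆ Metric.closedBall 0 R) (hDr : D =ᵐ[volume] Metric.closedBall (0 : ℂ) r) :
    μ.real (voidEvent 𝒦 D) ≤ outageBound (-1 / (m : ℝ)) ρ r := by
  set a : ℕ → ℝ := fun n =>
    (∫⁻ ω, (factorialCount (𝒦 ω) n (Set.univ.pi fun _ => D) : ENNReal) ∂μ).toReal / n.factorial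
    with ha
  set S := ∑' l, ginibreEigenvalue ρ r l with hS
  have hbonf : ∀ k : ℕ, μ.real (voidEvent 𝒦 D) ≤
      ∑ n ∈ Finset.range (2 * k + 1), (-1) ^ n * a n := fun k =>
    h𝒦.toIsPointProcess.measureReal_voidEvent_le hDm
      (fun n => h𝒦.factorial_moment_ne_top n _ (MeasurableSet.univ_pi fun _ => hDm)
        (fun x hx i => hDO (hx i (Set.mem_univ i)))) k
  have hSlim : Tendsto (fun L => ∑ p, splitEigenvalue ρ r L m p) atTop (𝓝 S) := by
    simp_rw [sum_splitEigenvalue ρ r _ hm]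
    exact (summable_ginibreEigenvalue hρ.le r).hasSum.tendsto_sum_nat
  have hBlim : Tendsto (fun L => ∏ p, (1 - splitEigenvalue ρ r L m p)) atTop
      (𝓝 (outageBound (-1 / (m : ℝ)) ρ r)) := by
    simp_rw [prod_one_sub_splitEigenvalue, outageBound_eq_pow hm]
    exact (multipliable_boundFactor hρ.le _ r).hasProd.tendsto_prod_nat.pow m
  have hk : ∀ k : ℕ, |∑ n ∈ Finset.range k, (-1) ^ n * a n - outageBound (-1 / (m : ℝ)) ρ r| ≤
      Real.exp S - ∑ n ∈ Finset.range k, S ^ n / n.factorial := by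
    intro k
    -- Here `k` is fixed and `L → ∞`: each of the finitely many symmetric functions converges to its
    -- factorial moment.
    refine le_of_tendsto_of_tendsto'
      (((tendsto_finsetSum (Finset.range k) fun n _ =>
        (tendsto_factorial_moment hρ hm h𝒦 hr hDm hDO hDr n).const_mul ((-1) ^ n)).sub hBlim).abs)
      (((Real.continuous_exp.tendsto S).comp hSlim).sub
        (tendsto_finsetSum (Finset.range k) fun n _ => (hSlim.pow n).div_const _)) fun L => ?_
    exact abs_sum_range_sub_prod_one_sub_le _
      (fun p => div_nonneg (ginibreEigenvalue_nonneg hρ.le r _) (by positivity)) k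
  have hexp : Tendsto (fun k => outageBound (-1 / (m : ℝ)) ρ r +
      (Real.exp S - ∑ n ∈ Finset.range (2 * k + 1), S ^ n / n.factorial)) atTop
      (𝓝 (outageBound (-1 / (m : ℝ)) ρ r)) := by
    have h := (NormedSpace.expSeries_div_hasSum_exp S).tendsto_sum_nat
    rw [← Real.exp_eq_exp_ℝ] at h
    have h2 : Tendsto (fun k : ℕ => 2 * k + 1) atTop atTop :=
      tendsto_atTop_mono (fun k : ℕ => (by omega : k ≤ 2 * k + 1)) tendsto_id
    simpa using ((h.comp h2).const_sub (Real.exp S)).const_add (outageBound (-1 / (m : ℝ)) ρ r)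
  -- Only partial sums of odd length enter, since those are the ones that bound from above.
  refine ge_of_tendsto' hexp fun k => ?_
  have := (abs_le.1 (hk (2 * k + 1))).2
  linarith [hbonf k]

end AlphaDPP

/-! ### From harvested power to empty discs. -/

section Harvesting

variable {β PS GS GH wl PC ε : ℝ}

theorem le_sourcePower (hβ : 0 < β) (hPS : 0 < PS) (hGS : 0 < GS) (hGH : 0 < GH)
    (hwl : 0 < wl) (hPC : 0 < PC) (hε : 0 ≤ ε) {x : ℂ}
    (hx : ‖x‖ ≤ gammaRadius β PS GS GH wl PC - ε) :
    ENNReal.ofReal PC ≤ sourcePower β PS GS GH wl ε x := by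
  have hc : 0 < β * PS * GS * GH * wl ^ 2 := by positivity
  have hpi := Real.pi_pos
  rw [sourcePower, ENNReal.le_div_iff_mul_le (Or.inr (by simpa using hc))
    (Or.inr ENNReal.ofReal_ne_top), ← ENNReal.ofReal_mul hPC.le]
  refine ENNReal.ofReal_le_ofReal ?_
  have h1 : (ε + ‖x‖) ^ 2 ≤ β * PS * GS * GH * wl ^ 2 / ((4 * Real.pi) ^ 2 * PC) := by
    refine (Real.le_sqrt (by positivity) (by positivity)).1 ?_
    change ε + ‖x‖ ≤ gammaRadius β PS GS GH wl PC
    linarith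
  rw [le_div_iff₀ (by positivity)] at h1
  linarith

theorem outage_subset_voidEvent {Ω : Type*} {𝒦 : Ω → Set ℂ} (hβ : 0 < β) (hPS : 0 < PS)
    (hGS : 0 < GS) (hGH : 0 < GH) (hwl : 0 < wl) (hPC : 0 < PC) (hε : 0 ≤ ε) {s : ℝ}
    (hs : s ≤ gammaRadius β PS GS GH wl PC - ε) :
    {ω | harvestedPower β PS GS GH wl ε (𝒦 ω) < ENNReal.ofReal PC} ⊆
      voidEvent 𝒦 (Metric.closedBall 0 s) := by
  intro ω hω
  refine Set.eq_empty_of_forall_notMem fun x hx => ?_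
  have hxs : ‖x‖ ≤ s := by simpa using hx.2
  exact (Set.mem_ofPred.1 hω).not_ge
    ((le_sourcePower hβ hPS hGS hGH hwl hPC hε (hxs.trans hs)).trans
      (ENNReal.le_tsum (f := fun y : 𝒦 ω => sourcePower β PS GS GH wl ε y) ⟨x, hx.1⟩))

theorem harvestedPower_antitone {δ : ℝ} (hε : 0 ≤ ε) (h : ε ≤ δ) (S : Set ℂ) :
    harvestedPower β PS GS GH wl δ S ≤ harvestedPower β PS GS GH wl ε S := by
  have hpi := Real.pi_pos
  refine ENNReal.tsum_le_tsum fun x => ENNReal.div_le_div_left (ENNReal.ofReal_le_ofReal ?_) _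
  gcongr

theorem outageProb_monotoneOn {Ω : Type*} [MeasurableSpace Ω] (μ : Measure Ω)
    [IsFiniteMeasure μ] (𝒦 : Ω → Set ℂ) :
    MonotoneOn (fun ε => outageProb μ 𝒦 β PS GS GH wl PC ε) (Set.Ici 0) :=
  fun _ hε _ _ h => measureReal_mono fun _ hω => (harvestedPower_antitone hε h _).trans_lt hω

end Harvesting

/-! ### Vanishing regularisation. -/

/-- The closed discs increase to the open disc, so the void events decrease to its void event and
continuity from above applies. -/
theorem tendsto_measureReal_voidEvent_closedBall {Ω : Type*} [MeasurableSpace Ω] {μ : Measure Ω}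
    [IsFiniteMeasure μ] {O : Set ℂ} {𝒦 : Ω → Set ℂ} (h : IsPointProcess μ O 𝒦) {s : ℕ → ℝ} {r : ℝ}
    (hs : Monotone s) (hlt : ∀ j, s j < r) (hlim : Tendsto s atTop (𝓝 r)) :
    Tendsto (fun j => μ.real (voidEvent 𝒦 (Metric.closedBall 0 (s j)))) atTop
      (𝓝 (μ.real (voidEvent 𝒦 (Metric.ball 0 r)))) := by
  have hInter : voidEvent 𝒦 (Metric.ball 0 r) =
      ⋂ j, voidEvent 𝒦 (Metric.closedBall 0 (s j)) := by
    ext ω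
    simp only [voidEvent, Set.mem_iInter, Set.mem_ofPred_eq, Set.eq_empty_iff_forall_notMem,
      Set.mem_inter_iff, not_and, mem_ball_zero_iff, mem_closedBall_zero_iff]
    refine ⟨fun hω j x hx hxs => hω x hx (hxs.trans_lt (hlt j)), fun hω x hx hxr => ?_⟩
    obtain ⟨j, hj⟩ := (hlim.eventually (lt_mem_nhds hxr)).exists
    exact hω j x hx hj.le
  rw [hInter]
  refine (ENNReal.tendsto_toReal (measure_ne_top μ _)).comp (tendsto_measure_iInter_atTop
    (fun j => (h.measurableSet_voidEvent Metric.isClosed_closedBall.measurableSet).nullMeasurableSet)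
    (fun i j hij ω hω => ?_) ⟨0, measure_ne_top μ _⟩)
  exact Set.subset_eq_empty
    (Set.inter_subset_inter_right _ (Metric.closedBall_subset_closedBall (hs hij))) hω

end

theorem ball_ae_eq_closedBall (x : ℂ) (r : ℝ) :
    Metric.ball x r =ᵐ[volume] Metric.closedBall x r := by
  rcases eq_or_ne r 0 with rfl | hr
  -- At radius zero the two balls are the empty set and a single point, which is null.
  · rw [Metric.ball_zero, Metric.closedBall_zero]
    exact (ae_eq_empty.2 (measure_singleton x)).symm
  · exact ae_eq_of_subset_of_measure_ge Metric.ball_subset_closedBall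
      (Measure.addHaar_closedBall_eq_addHaar_ball volume x r).le
      Metric.isOpen_ball.measurableSet.nullMeasurableSet
      (measure_closedBall_lt_top.ne)

theorem theorem2 {Ω : Type*} [MeasurableSpace Ω] (μ : Measure Ω) [IsProbabilityMeasure μ]
    (m : ℕ) (hm : 0 < m) (α : ℝ) (hα : α = -1 / (m : ℝ))
    (ρ R : ℝ) (hρ : 0 < ρ) (hR : 0 < R)
    (𝒦 : Ω → Set ℂ)
    (h𝒦 : IsAlphaDPP μ (Metric.closedBall (0 : ℂ) R) α (ginibreKernel ρ) 𝒦)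
    (β PS GS GH wl PC : ℝ) (hβ : 0 < β) (hPS : 0 < PS) (hGS : 0 < GS) (hGH : 0 < GH)
    (hwl : 0 < wl) (hPC : 0 < PC) (γ : ℝ) (hγ : γ = gammaRadius β PS GS GH wl PC) :
    -- the infinite products converge
    (∀ r : ℝ, Multipliable (boundFactor α ρ r)) ∧
    -- the unregularised model, `ε = 0`
    outageProb μ 𝒦 β PS GS GH wl PC 0 ≤ outageBound α ρ (min R γ) ∧
    -- the regularised model, for a fixed `ε ∈ [0, γ]`
    (∀ ε : ℝ, 0 ≤ ε → ε ≤ γ →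
      outageProb μ 𝒦 β PS GS GH wl PC ε ≤ outageBound α ρ (min R (γ - ε))) ∧
    -- the regularised model, in the limit of a vanishing `ε > 0`
    (∃ φ : ℝ, Tendsto (fun ε : ℝ => outageProb μ 𝒦 β PS GS GH wl PC ε) (𝓝[>] 0) (𝓝 φ) ∧
      φ ≤ outageBound α ρ (min R γ)) := by
  subst hα hγ
  set γ := gammaRadius β PS GS GH wl PC with hγ
  have hpi := Real.pi_pos
  have hγ0 : 0 < γ := Real.sqrt_pos.2 (by positivity)
  have hfixed : ∀ ε : ℝ, 0 ≤ ε → ε ≤ γ →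
      outageProb μ 𝒦 β PS GS GH wl PC ε ≤ outageBound (-1 / (m : ℝ)) ρ (min R (γ - ε)) := by
    intro ε hε hεγ
    refine (measureReal_mono (outage_subset_voidEvent hβ hPS hGS hGH hwl hPC hε
      (min_le_right R (γ - ε)))).trans ?_
    exact measureReal_voidEvent_le_outageBound hρ hm h𝒦 (le_min hR.le (by linarith))
      Metric.isClosed_closedBall.measurableSet
      (Metric.closedBall_subset_closedBall (min_le_left _ _)) (ae_eq_refl _)
  refine ⟨multipliable_boundFactor hρ.le _, by simpa using hfixed 0 le_rfl hγ0.le, hfixed, ?_⟩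
  have hmono : MonotoneOn (fun ε => outageProb μ 𝒦 β PS GS GH wl PC ε) (Set.Ioi 0) :=
    (outageProb_monotoneOn μ 𝒦).mono Set.Ioi_subset_Ici_self
  have hbdd : BddBelow ((fun ε => outageProb μ 𝒦 β PS GS GH wl PC ε) '' Set.Ioi 0) :=
    ⟨0, by rintro _ ⟨ε, -, rfl⟩; exact measureReal_nonneg⟩
  -- By monotonicity the limit is the infimum over `ε > 0`, so it can be bounded along any chosen
  -- sequence of `ε`.
  refine ⟨_, hmono.tendsto_nhdsGT hbdd, ?_⟩
  set r := min R γ with hr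
  have hr0 : 0 < r := lt_min hR hγ0
  have hlim : Tendsto (fun j : ℕ => r - r * (1 / ((j : ℝ) + 1))) atTop (𝓝 r) := by
    simpa using (tendsto_one_div_add_atTop_nhds_zero_nat (𝕜 := ℝ)).const_mul r |>.const_sub r
  have hvoid := tendsto_measureReal_voidEvent_closedBall h𝒦.toIsPointProcess
    (s := fun j : ℕ => r - r * (1 / ((j : ℝ) + 1))) (r := r)
    (fun i j hij => by
      have := Nat.one_div_le_one_div (α := ℝ) hij
      dsimp only
      gcongr)
    (fun j => sub_lt_self r (mul_pos hr0 Nat.one_div_pos_of_nat)) hlim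
  refine (ge_of_tendsto' hvoid fun j => ?_).trans
    (measureReal_voidEvent_le_outageBound hρ hm h𝒦 hr0.le Metric.isOpen_ball.measurableSet
      (Metric.ball_subset_closedBall.trans (Metric.closedBall_subset_closedBall (min_le_left _ _)))
      (ball_ae_eq_closedBall 0 r))
  -- This value of `ε` is exactly `r` minus the `j`-th radius, so that radius is at most `γ - ε`
  -- because `r ≤ γ`.
  have hε : 0 < r * (1 / ((j : ℝ) + 1)) := mul_pos hr0 Nat.one_div_pos_of_nat
  exact (csInf_le hbdd ⟨_, hε, rfl⟩).trans (measureReal_mono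
    (outage_subset_voidEvent hβ hPS hGS hGH hwl hPC hε.le
      (sub_le_sub_right (min_le_right R γ) _)))
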